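/- Let $Q$ be a smooth finite-dimensional manifold (without boundary), with projections $\tau_Q:TQ\to Q$, $\pi_Q:T^*Q\to Q$. A discretization map on $Q$ is a smooth map $R_d=(R^1,R^2):U\to Q\times Q$ on an open neighbourhood $U\subset TQ$ of the zero section with $R_d(x,0)=(x,x)$ and $T_{0_x}R^2_x-T_{0_x}R^1_x=\mathrm{Id}_{T_xQ}$ for all $x\in Q$, where $R^a_x=R^a|_{T_xQ\cap U}$. Notation. In induced local coordinates let $\kappa_Q:TTQ\to TTQ$, $\kappa_Q(q,v,\dot q,\dot v)=(q,\dot q,v,\dot v)$ be the canonical involution, let $\alpha_Q:TT^*Q\to T^*TQ$, $\alpha_Q(q,p,\dot q,\dot p)=(q,\dot q,\dot p,p)$ be the canonical isomorphism, and let $\Phi:T^*Q\times T^*Q\to T^*(Q\times Q)$, $\Phi(q_0,p_0;q_1,p_1)=(q_0,q_1,-p_0,p_1)$. The tangent lift of $R_d$ is $R_d^T=TR_d\circ\kappa_Q$, with values in $T(Q\times Q)\equiv TQ\times TQ$. On any open set $V\subset U$ that $R_d$ maps diffeomorphically onto an open subset of $Q\times Q$, write $R_d^{-1}:R_d(V)\to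 V$ for the inverse, $\widehat{R_d}(\alpha_x)=\alpha_x\circ T_{R_d(x)}R_d^{-1}$ for $\alpha_x\in T^*_xTQ$, $x\in V$, and let $R_d^{T^*}=\Phi^{-1}\circ\widehat{R_d}\circ\alpha_Q$ be the cotangent lift; it is a bijection from $\{v\in TT^*Q: T\pi_Q(v)\in V\}$ onto $\{(\alpha_{q_0},\alpha_{q_1})\in T^*Q\times T^*Q:(q_0,q_1)\in R_d(V)\}$. The pairing $\langle v,u\rangle^T\in\mathbb R$ of $v\in TT^*Q$ and $u\in TTQ$ with $T\pi_Q(v)=T\tau_Q(u)$ is $$\langle v,u\rangle^T=\frac{d}{dt}\Big|_{t=0}\langle\sigma(t),\gamma(t)\rangle ,$$ for any smooth curves $\sigma$ in $T^*Q$ and $\gamma$ in $TQ$ with $\pi_Q\circ\sigma=\tau_Q\circ\gamma$ near $0$, $\dot\sigma(0)=v$, $\dot\gamma(0)=u$. Proposition. Let $R_d:U\to Q\times Q$ be a discretization map and let $V\subset U$ be any open set which $R_d$ maps diffeomorphically onto an open subset of $Q\times Q$. Let $\alpha_{q_0}\in T^*_{q_0}Q$, $\alpha_{q_1}\in T^*_{q_1}Q$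 with $(q_0,q_1)\in R_d(V)$, and let $w\in TTQ$ satisfy $R_d^{-1}(q_0,q_1)=T\tau_Q(w)$. Then the pairing $\langle (R_d^{T^*})^{-1}(\alpha_{q_0},\alpha_{q_1}),w\rangle^T$ is well defined (curves as above exist and all give the same value), and $$\big\langle\Phi(\alpha_{q_0},\alpha_{q_1}),R_d^T(w)\big\rangle=\big\langle (R_d^{T^*})^{-1}(\alpha_{q_0},\alpha_{q_1}),\,w\big\rangle^T .$$ -/

import Mathlib

open Bundle Set Filter Topology
open scoped Manifold ContDiff

noncomputable section

namespace DiscretizationMap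

section Cotangent

variable {E : Type*} [NormedAddCommGroup E] [NormedSpace ℝ E]
  {H : Type*} [TopologicalSpace H] (I : ModelWithCorners ℝ E H)
  (M : Type*) [TopologicalSpace M] [ChartedSpace H M]

/-- The cotangent bundle `T*M`: the bundle over `M` whose fibre at `x` is the continuous dual of
`T_x M`. Its topology and smooth structure are Mathlib's for the bundle of continuous linear maps
from the tangent bundle to the trivial line bundle. -/
abbrev CotangentBundle : Type _ :=
  TotalSpace (E →L[ℝ] ℝ) (fun x : M ↦ TangentSpace I x →L[ℝ] Bundle.Trivial M ℝ x)

/-- The model with corners of `T*M` over a manifold `M` modelled with `I`. -/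
abbrev cotangentModel : ModelWithCorners ℝ (E × (E →L[ℝ] ℝ)) (ModelProd H (E →L[ℝ] ℝ)) :=
  I.prod 𝓘(ℝ, E →L[ℝ] ℝ)

variable {I M}

open Classical in
/-- The canonical pairing `⟨α, u⟩` of a covector `α ∈ T*_x M` with a vector `u ∈ T_x M` at the
same point (and the dummy value `0` when the base points differ). -/
def canonicalPairing (α : CotangentBundle I M) (u : TangentBundle I M) : ℝ :=
  if h : u.proj = α.proj then
    (α.2 : TangentSpace I α.proj →L[ℝ] ℝ) (cast (congrArg (TangentSpace I (M := M)) h) u.2)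
  else 0

/-- The velocity at time `0` of a curve in `M`, as a point of `TM`. -/
def velocity (I : ModelWithCorners ℝ E H) (c : ℝ → M) : TangentBundle I M :=
  tangentMap 𝓘(ℝ, ℝ) I c ⟨0, (1 : ℝ)⟩

end Cotangent

section CotangentLift

variable {E : Type*} [NormedAddCommGroup E] [NormedSpace ℝ E]
  {H : Type*} [TopologicalSpace H] {I : ModelWithCorners ℝ E H}
  {M : Type*} [TopologicalSpace M] [ChartedSpace H M]
  {E' : Type*} [NormedAddCommGroup E'] [NormedSpace ℝ E']
  {H' : Type*} [TopologicalSpace H'] {J : ModelWithCorners ℝ E' H'}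
  {N : Type*} [TopologicalSpace N] [ChartedSpace H' N]

/-- The fibrewise map `T*G : T*M → T*N`, for a map `G : N → M` with inverse `F : M → N`:
it sends `α ∈ T*_x M` to `α ∘ T_{F x} G ∈ T*_{F x} N`. -/
def cotangentMap (F : M → N) (G : N → M) (α : CotangentBundle I M) : CotangentBundle J N :=
  ⟨F α.proj, (α.2 : E →L[ℝ] ℝ).comp (mfderiv J I G (F α.proj) : E' →L[ℝ] E)⟩

theorem cotangentMap_leftInv (F : PartialDiffeomorph I J M N ∞) (α : CotangentBundle I M)
    (hα : α.proj ∈ F.source) :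
    cotangentMap (I := J) (J := I) F.symm F (cotangentMap (J := J) F F.symm α) = α := by
  obtain ⟨x, p⟩ := α
  have hx : F.symm (F x) = x := F.left_inv hα
  have hFx : F x ∈ F.target := F.map_source hα
  have h1 : HasMFDerivAt I J F x (mfderiv I J F x) :=
    ((F.contMDiffOn_toFun.contMDiffAt (F.open_source.mem_nhds hα)).mdifferentiableAt
      (by simp)).hasMFDerivAt
  have h2 : HasMFDerivAt J I F.symm (F x) (mfderiv J I F.symm (F x)) :=
    ((F.contMDiffOn_invFun.contMDiffAt (F.open_target.mem_nhds hFx)).mdifferentiableAt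
      (by simp)).hasMFDerivAt
  have h3 := h2.comp x h1
  have h4 : HasMFDerivAt I I (F.symm ∘ F) x (ContinuousLinearMap.id ℝ (TangentSpace I x)) := by
    refine (hasMFDerivAt_id x).congr_of_eventuallyEq ?_
    filter_upwards [F.open_source.mem_nhds hα] with y hy using F.left_inv hy
  have h5 := hasMFDerivAt_unique h3 h4
  unfold cotangentMap
  refine TotalSpace.ext hx (heq_of_eq ?_)
  change ((p : E →L[ℝ] ℝ).comp (mfderiv J I F.symm (F x) : E' →L[ℝ] E)).comp
    (mfderiv I J F (F.symm (F x)) : E →L[ℝ] E') = (p : E →L[ℝ] ℝ)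
  rw [hx]
  refine ContinuousLinearMap.ext fun a ↦ ?_
  exact congrArg (p : E →L[ℝ] ℝ) (DFunLike.congr_fun h5 a)

/-- For a diffeomorphism `F` from an open subset of `M` onto an open subset of `N`, the map
`F̂ = T*(F⁻¹)`, `α_x ↦ α_x ∘ T_{F x}(F⁻¹)`, from the covectors over the domain of `F` onto the
covectors over its image. Its inverse is `T*F`. -/
def cotangentLiftOfDiffeo (F : PartialDiffeomorph I J M N ∞) :
    PartialEquiv (CotangentBundle I M) (CotangentBundle J N) where
  toFun := cotangentMap F F.symm
  invFun := cotangentMap F.symm F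
  source := {α | α.proj ∈ F.source}
  target := {β | β.proj ∈ F.target}
  map_source' _ hα := F.map_source hα
  map_target' _ hβ := F.map_target hβ
  left_inv' α hα := cotangentMap_leftInv F α hα
  right_inv' β hβ := cotangentMap_leftInv F.symm β hβ

end CotangentLift

section Lifts

variable {E : Type*} [NormedAddCommGroup E] [NormedSpace ℝ E]
  {H : Type*} [TopologicalSpace H] {I : ModelWithCorners ℝ E H}
  {Q : Type*} [TopologicalSpace Q] [ChartedSpace H Q]

/-- The tangent map at `0_x` of the restriction of `f : TQ → Q` to `T_x Q`, as an endomorphism of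
`T_x Q`, for a map `f` with `f(0_x) = x`; here `T_{0_x} T_x Q` is identified with `T_x Q`. -/
def fibreDeriv (f : TangentBundle I Q → Q) (x : Q) : TangentSpace I x →L[ℝ] TangentSpace I x :=
  (mfderiv 𝓘(ℝ, E) I (fun v : E ↦ f ⟨x, v⟩) 0 : E →L[ℝ] E)

/-- `R = (R¹, R²) : U ⊆ TQ → Q × Q` is a (smooth) discretization map on `Q`: `U` is an open
neighbourhood of the zero section, `R(x, 0) = (x, x)`, and the derivative at `0_x` of
`R²_x - R¹_x` is the identity of `T_x Q`. (The values of `R` outside `U` are irrelevant.) -/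
structure IsDiscretizationMap [IsManifold I ∞ Q] (U : Set (TangentBundle I Q))
    (R : TangentBundle I Q → Q × Q) : Prop where
  isOpen : IsOpen U
  zero_mem : ∀ x : Q, (⟨x, (0 : E)⟩ : TangentBundle I Q) ∈ U
  smooth : ContMDiffOn I.tangent (I.prod I) ∞ R U
  map_zero : ∀ x : Q, R ⟨x, (0 : E)⟩ = (x, x)
  deriv_sub : ∀ x : Q, fibreDeriv (fun z ↦ (R z).2) x - fibreDeriv (fun z ↦ (R z).1) x
    = ContinuousLinearMap.id ℝ (TangentSpace I x)

/-- The canonical involution `κ_Q : TTQ → TTQ`, `(q, v, q̇, v̇) ↦ (q, q̇, v, v̇)`.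

The coordinates are those induced on `TTQ` by the preferred chart of `Q` at `q`: in Mathlib a
tangent vector of `TQ` at `(q, v)` is the element `(q̇, v̇)` of `E × E` which represents it in the
preferred chart of `TQ` at `(q, v)`, and that chart is the one induced by the preferred chart of
`Q` at `q`. -/
def canonicalInvolution [IsManifold I ∞ Q]
    (z : TangentBundle I.tangent (TangentBundle I Q)) :
    TangentBundle I.tangent (TangentBundle I Q) :=
  ⟨⟨z.proj.proj, (z.2 : E × E).1⟩, ((z.proj.2 : E), (z.2 : E × E).2)⟩

/-- The canonical isomorphism `α_Q : TT*Q → T*TQ`, `(q, p, q̇, ṗ) ↦ (q, q̇, ṗ, p)`; that is, the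
image is the covector `(a, b) ↦ ṗ(a) + p(b)` at the point `(q, q̇)` of `TQ`. As for the canonical
involution, the coordinates are those induced by the preferred chart of `Q` at `q`. -/
def tulczyjewEquiv [IsManifold I ∞ Q] :
    TangentBundle (cotangentModel I) (CotangentBundle I Q) ≃
      CotangentBundle I.tangent (TangentBundle I Q) where
  toFun v :=
    ⟨⟨v.proj.proj, (v.2 : E × (E →L[ℝ] ℝ)).1⟩,
      ((v.2 : E × (E →L[ℝ] ℝ)).2.coprod (v.proj.2 : E →L[ℝ] ℝ) : E × E →L[ℝ] ℝ)⟩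
  invFun β :=
    ⟨⟨β.proj.proj, (β.2 : E × E →L[ℝ] ℝ).comp (ContinuousLinearMap.inr ℝ E E)⟩,
      ((β.proj.2 : E), (β.2 : E × E →L[ℝ] ℝ).comp (ContinuousLinearMap.inl ℝ E E))⟩
  left_inv v := by
    obtain ⟨⟨q, p⟩, w⟩ := v
    exact congrArg₂ (fun a b : E →L[ℝ] ℝ ↦
      (⟨⟨q, a⟩, ((w : E × (E →L[ℝ] ℝ)).1, b)⟩ :
        TangentBundle (cotangentModel I) (CotangentBundle I Q)))
      (ContinuousLinearMap.coprod_comp_inr (w : E × (E →L[ℝ] ℝ)).2 (p : E →L[ℝ] ℝ))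
      (ContinuousLinearMap.coprod_comp_inl (w : E × (E →L[ℝ] ℝ)).2 (p : E →L[ℝ] ℝ))
  right_inv β := by
    obtain ⟨⟨q, u⟩, b⟩ := β
    refine TotalSpace.ext rfl (heq_of_eq ?_)
    exact ContinuousLinearMap.coprod_comp_inl_inr (b : E × E →L[ℝ] ℝ)

/-- The diffeomorphism `Φ : T*Q × T*Q → T*(Q × Q)`, `(α₀, α₁) ↦ (-α₀, α₁)`. -/
def signedProdEquiv :
    CotangentBundle I Q × CotangentBundle I Q ≃ CotangentBundle (I.prod I) (Q × Q) where
  toFun α := ⟨(α.1.proj, α.2.proj),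
    ((-(α.1.2 : E →L[ℝ] ℝ)).coprod (α.2.2 : E →L[ℝ] ℝ) : E × E →L[ℝ] ℝ)⟩
  invFun β :=
    (⟨β.proj.1, -((β.2 : E × E →L[ℝ] ℝ).comp (ContinuousLinearMap.inl ℝ E E))⟩,
      ⟨β.proj.2, (β.2 : E × E →L[ℝ] ℝ).comp (ContinuousLinearMap.inr ℝ E E)⟩)
  left_inv α := by
    obtain ⟨⟨q, p⟩, ⟨q', p'⟩⟩ := α
    exact congrArg₂ (fun a b : E →L[ℝ] ℝ ↦
      ((⟨q, a⟩, ⟨q', b⟩) : CotangentBundle I Q × CotangentBundle I Q))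
      ((congrArg Neg.neg (ContinuousLinearMap.coprod_comp_inl (-(p : E →L[ℝ] ℝ))
        (p' : E →L[ℝ] ℝ))).trans (neg_neg _))
      (ContinuousLinearMap.coprod_comp_inr (-(p : E →L[ℝ] ℝ)) (p' : E →L[ℝ] ℝ))
  right_inv β := by
    obtain ⟨q, b⟩ := β
    refine TotalSpace.ext rfl (heq_of_eq ?_)
    change (- -((b : E × E →L[ℝ] ℝ).comp (ContinuousLinearMap.inl ℝ E E))).coprod
      ((b : E × E →L[ℝ] ℝ).comp (ContinuousLinearMap.inr ℝ E E)) = (b : E × E →L[ℝ] ℝ)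
    rw [neg_neg]
    exact ContinuousLinearMap.coprod_comp_inl_inr (b : E × E →L[ℝ] ℝ)

/-- The tangent lift `R^T = TR ∘ κ_Q` of `R : TQ → Q × Q`, with `T(Q × Q)` identified with
`TQ × TQ`. -/
def tangentLift [IsManifold I ∞ Q] (R : TangentBundle I Q → Q × Q)
    (w : TangentBundle I.tangent (TangentBundle I Q)) :
    TangentBundle I Q × TangentBundle I Q :=
  equivTangentBundleProd I Q I Q (tangentMap I.tangent (I.prod I) R (canonicalInvolution w))

/-- The cotangent lift `R^{T*} = Φ⁻¹ ∘ R̂ ∘ α_Q` of a diffeomorphism `R` from an open subset `V`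
of `TQ` onto an open subset of `Q × Q`, as a bijection from the set of the `v ∈ TT*Q` with
`Tπ_Q(v) ∈ V` onto the set of the `(α₀, α₁) ∈ T*Q × T*Q` with base points in `R(V)`. -/
def cotangentLift [IsManifold I ∞ Q]
    (R : PartialDiffeomorph I.tangent (I.prod I) (TangentBundle I Q) (Q × Q) ∞) :
    PartialEquiv (TangentBundle (cotangentModel I) (CotangentBundle I Q))
      (CotangentBundle I Q × CotangentBundle I Q) :=
  (tulczyjewEquiv.toPartialEquiv.trans (cotangentLiftOfDiffeo R)).trans
    signedProdEquiv.symm.toPartialEquiv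

/-- Curves `σ` in `T*Q` and `γ` in `TQ`, smooth and over the same curve of `Q` near time `0`,
with velocities `v ∈ TT*Q` and `u ∈ TTQ` at time `0`. -/
structure AdaptedCurves [IsManifold I ∞ Q]
    (v : TangentBundle (cotangentModel I) (CotangentBundle I Q))
    (u : TangentBundle I.tangent (TangentBundle I Q))
    (σ : ℝ → CotangentBundle I Q) (γ : ℝ → TangentBundle I Q) : Prop where
  smooth_left : ContMDiffAt 𝓘(ℝ, ℝ) (cotangentModel I) ∞ σ 0
  smooth_right : ContMDiffAt 𝓘(ℝ, ℝ) I.tangent ∞ γ 0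
  proj_eq : ∀ᶠ t in 𝓝 0, (σ t).proj = (γ t).proj
  velocity_left : velocity (cotangentModel I) σ = v
  velocity_right : velocity I.tangent γ = u

/-- `⟨v, u⟩^T` is defined and equal to `r`: there are adapted curves for `v ∈ TT*Q` and `u ∈ TTQ`,
and `d/dt ⟨σ(t), γ(t)⟩ = r` at `t = 0` for all of them. -/
def HasTangentPairing [IsManifold I ∞ Q]
    (v : TangentBundle (cotangentModel I) (CotangentBundle I Q))
    (u : TangentBundle I.tangent (TangentBundle I Q)) (r : ℝ) : Prop :=
  (∃ σ γ, AdaptedCurves v u σ γ) ∧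
    ∀ σ γ, AdaptedCurves v u σ γ → HasDerivAt (fun t ↦ canonicalPairing (σ t) (γ t)) r 0

open Classical in
/-- The pairing `⟨v, u⟩^T` of `v ∈ TT*Q` with `u ∈ TTQ` (and the dummy value `0` when it is not
defined, which happens if `Tπ_Q(v) ≠ Tτ_Q(u)`). -/
def tangentPairing [IsManifold I ∞ Q]
    (v : TangentBundle (cotangentModel I) (CotangentBundle I Q))
    (u : TangentBundle I.tangent (TangentBundle I Q)) : ℝ :=
  if h : ∃ r, HasTangentPairing v u r then h.choose else 0

end Lifts

end DiscretizationMap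

end

/-!
The pairing `⟨v, u⟩ᵀ` is the canonical pairing of `α_Q(v) ∈ T*TQ` with `κ_Q(u) ∈ TTQ`: in the
coordinates induced by a chart, Leibniz' rule for `⟨σ, γ⟩` gives `ṗ(x) + p(ẋ)`, which is the
covector `(ṗ, p)` evaluated at `(x, ẋ)`. If `v = (R_d^{T*})⁻¹(α₀, α₁)`, then
`α_Q(v) = T*R_d (Φ(α₀, α₁))`, and the cotangent map of `R_d` is the fibrewise transpose of `TR_d`.
Hence `⟨v, w⟩ᵀ = ⟨T*R_d Φ(α₀, α₁), κ_Q w⟩ = ⟨Φ(α₀, α₁), TR_d (κ_Q w)⟩`.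
-/

namespace DiscretizationMap

section Curves

variable {E : Type*} [NormedAddCommGroup E] [NormedSpace ℝ E]
  {H : Type*} [TopologicalSpace H] {I : ModelWithCorners ℝ E H}
  {M : Type*} [TopologicalSpace M] [ChartedSpace H M]

theorem hasDerivAt_extChartAt_comp {c : ℝ → M} (hc : MDifferentiableAt 𝓘(ℝ, ℝ) I c 0) :
    HasDerivAt (fun t ↦ extChartAt I (c 0) (c t)) ((velocity I c).2 : E) 0 := by
  let L : ℝ →L[ℝ] E := mfderiv 𝓘(ℝ, ℝ) I c 0
  have hL : HasFDerivWithinAt (fun t ↦ extChartAt I (c 0) (c t)) L univ 0 := by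
    rw [← range_id]
    exact hc.hasMFDerivAt.2
  exact (hasFDerivWithinAt_univ.1 hL).hasDerivAt

theorem tangentMap_velocity {E' : Type*} [NormedAddCommGroup E'] [NormedSpace ℝ E']
    {H' : Type*} [TopologicalSpace H'] {J : ModelWithCorners ℝ E' H'}
    {N : Type*} [TopologicalSpace N] [ChartedSpace H' N] {f : M → N} {c : ℝ → M}
    (hf : MDifferentiableAt I J f (c 0)) (hc : MDifferentiableAt 𝓘(ℝ, ℝ) I c 0) :
    tangentMap I J f (velocity I c) = velocity J (f ∘ c) :=
  (tangentMap_comp_at _ hf hc).symm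

/-- The curve through `x` which is the line with direction `X` in the preferred chart at `x`: a
representative of the tangent vector `X` at `x`. Outside a neighbourhood of time `0`, where the
line may leave the target of the chart, its values are irrelevant. -/
noncomputable def chartLine (I : ModelWithCorners ℝ E H) (x : M) (X : E) (t : ℝ) : M :=
  (extChartAt I x).symm (extChartAt I x x + t • X)

theorem chartLine_zero (x : M) (X : E) : chartLine I x X 0 = x := by
  simp [chartLine]

variable [I.Boundaryless]

theorem eventually_add_smul_mem_extChartAt_target (x : M) (X : E) :
    ∀ᶠ t : ℝ in 𝓝 0, extChartAt I x x + t • X ∈ (extChartAt I x).target := by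
  have hline : ContinuousAt (fun t : ℝ ↦ extChartAt I x x + t • X) 0 := by fun_prop
  exact hline.eventually_mem (by simpa using extChartAt_target_mem_nhds (I := I) x)

theorem contMDiffAt_chartLine {n : WithTop ℕ∞} (x : M) (X : E) :
    ContMDiffAt 𝓘(ℝ, ℝ) I n (chartLine I x X) 0 := by
  have hline : ContMDiffAt 𝓘(ℝ, ℝ) 𝓘(ℝ, E) n (fun t : ℝ ↦ extChartAt I x x + t • X) 0 :=
    ContDiff.contMDiff (by fun_prop) |>.contMDiffAt
  have hchart : ContMDiffAt 𝓘(ℝ, E) I n (extChartAt I x).symm (extChartAt I x x) :=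
    (contMDiffWithinAt_extChartAt_symm_target_self x).contMDiffAt (extChartAt_target_mem_nhds x)
  exact ContMDiffAt.comp (0 : ℝ) (by simpa using hchart) hline

theorem velocity_chartLine (x : M) (X : E) : velocity I (chartLine I x X) = ⟨x, X⟩ := by
  have hvelocity := hasDerivAt_extChartAt_comp
    ((contMDiffAt_chartLine (I := I) (n := 1) x X).mdifferentiableAt one_ne_zero)
  rw [chartLine_zero] at hvelocity
  have hline : HasDerivAt (fun t : ℝ ↦ extChartAt I x x + t • X) X 0 := by
    simpa using ((hasDerivAt_id (0 : ℝ)).smul_const X).const_add (extChartAt I x x)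
  have hchart : HasDerivAt (fun t ↦ extChartAt I x (chartLine I x X t)) X 0 :=
    hline.congr_of_eventuallyEq <|
      (eventually_add_smul_mem_extChartAt_target x X).mono fun _ ↦ (extChartAt I x).right_inv
  exact TotalSpace.ext (chartLine_zero x X) (heq_of_eq (hvelocity.unique hchart))

end Curves

section BundleProjection

variable {𝕜 : Type*} [NontriviallyNormedField 𝕜]
  {E : Type*} [NormedAddCommGroup E] [NormedSpace 𝕜 E]
  {H : Type*} [TopologicalSpace H] {I : ModelWithCorners 𝕜 E H}
  {M : Type*} [TopologicalSpace M] [ChartedSpace H M]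
  {F : Type*} [NormedAddCommGroup F] [NormedSpace 𝕜 F] {V : M → Type*}
  [TopologicalSpace (TotalSpace F V)] [∀ x, TopologicalSpace (V x)] [FiberBundle F V]

theorem proj_extChartAt_symm (z : TotalSpace F V) {y : E × F}
    (hy : y ∈ (extChartAt (I.prod 𝓘(𝕜, F)) z).target) :
    ((extChartAt (I.prod 𝓘(𝕜, F)) z).symm y).proj = (extChartAt I z.proj).symm y.1 := by
  rw [FiberBundle.extChartAt_target] at hy
  rw [FiberBundle.extChartAt]
  exact Trivialization.proj_symm_apply _ ((Trivialization.mem_target _).2 hy.1.2)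

theorem fst_extChartAt_self (z : TotalSpace F V) :
    (extChartAt (I.prod 𝓘(𝕜, F)) z z).1 = extChartAt I z.proj z.proj := by
  rw [FiberBundle.extChartAt]
  simp

theorem hasMFDerivAt_proj (z : TotalSpace F V) :
    HasMFDerivAt (I.prod 𝓘(𝕜, F)) I (TotalSpace.proj : TotalSpace F V → M) z
      (ContinuousLinearMap.fst 𝕜 E F) := by
  have hwritten : EqOn (writtenInExtChartAt (I.prod 𝓘(𝕜, F)) I z TotalSpace.proj) Prod.fst
      (extChartAt (I.prod 𝓘(𝕜, F)) z).target := fun y hy ↦ by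
    simp only [writtenInExtChartAt, Function.comp_apply, proj_extChartAt_symm z hy]
    rw [FiberBundle.extChartAt_target] at hy
    exact (extChartAt I z.proj).right_inv hy.1.1
  refine ⟨(FiberBundle.continuous_proj F V).continuousAt, ?_⟩
  exact (ContinuousLinearMap.fst 𝕜 E F).hasFDerivWithinAt.congr_of_eventuallyEq
    (hwritten.eventuallyEq_of_mem (extChartAt_target_mem_nhdsWithin z))
    (hwritten (mem_extChartAt_target z))

theorem tangentMap_totalSpaceProj (w : TangentBundle (I.prod 𝓘(𝕜, F)) (TotalSpace F V)) :
    tangentMap (I.prod 𝓘(𝕜, F)) I (TotalSpace.proj : TotalSpace F V → M) w =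
      ⟨w.proj.proj, (w.2 : E × F).1⟩ :=
  TotalSpace.ext rfl (heq_of_eq (DFunLike.congr_fun (hasMFDerivAt_proj w.proj).mfderiv w.2))

end BundleProjection

section TangentMap

variable {𝕜 : Type*} [NontriviallyNormedField 𝕜]
  {E : Type*} [NormedAddCommGroup E] [NormedSpace 𝕜 E]
  {H : Type*} [TopologicalSpace H] {I : ModelWithCorners 𝕜 E H}
  {M : Type*} [TopologicalSpace M] [ChartedSpace H M]
  {E' : Type*} [NormedAddCommGroup E'] [NormedSpace 𝕜 E']
  {H' : Type*} [TopologicalSpace H'] {J : ModelWithCorners 𝕜 E' H'}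
  {N : Type*} [TopologicalSpace N] [ChartedSpace H' N]

theorem tangentMap_congr_of_eventuallyEq {f g : M → N} {z : TangentBundle I M}
    (h : f =ᶠ[𝓝 z.proj] g) : tangentMap I J f z = tangentMap I J g z :=
  TotalSpace.ext h.eq_of_nhds (heq_of_eq (DFunLike.congr_fun h.mfderiv_eq z.2))

end TangentMap

section BundleCurves

variable {E : Type*} [NormedAddCommGroup E] [NormedSpace ℝ E]
  {H : Type*} [TopologicalSpace H] {I : ModelWithCorners ℝ E H}
  {M : Type*} [TopologicalSpace M] [ChartedSpace H M]
  {F : Type*} [NormedAddCommGroup F] [NormedSpace ℝ F] {V : M → Type*}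
  [TopologicalSpace (TotalSpace F V)] [∀ x, TopologicalSpace (V x)] [FiberBundle F V]

theorem hasDerivAt_trivializationAt_snd {c : ℝ → TotalSpace F V}
    (hc : MDifferentiableAt 𝓘(ℝ, ℝ) (I.prod 𝓘(ℝ, F)) c 0) :
    HasDerivAt (fun t ↦ (trivializationAt F V (c 0).proj (c t)).2)
      ((velocity (I.prod 𝓘(ℝ, F)) c).2 : E × F).2 0 := by
  have h := (hasDerivAt_extChartAt_comp hc).snd
  simp only [FiberBundle.extChartAt] at h
  exact h

theorem eventually_proj_chartLine [I.Boundaryless] (z : TotalSpace F V) (X : E × F) :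
    ∀ᶠ t in 𝓝 0, (chartLine (I.prod 𝓘(ℝ, F)) z X t).proj = chartLine I z.proj X.1 t := by
  filter_upwards [eventually_add_smul_mem_extChartAt_target (I := I.prod 𝓘(ℝ, F)) z X] with t ht
  rw [chartLine, proj_extChartAt_symm z ht, Prod.fst_add, fst_extChartAt_self, Prod.smul_fst,
    chartLine]

end BundleCurves

section CanonicalPairing

variable {E : Type*} [NormedAddCommGroup E] [NormedSpace ℝ E]
  {H : Type*} [TopologicalSpace H] {I : ModelWithCorners ℝ E H}
  {M : Type*} [TopologicalSpace M] [ChartedSpace H M]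

theorem canonicalPairing_eq_apply {α : CotangentBundle I M} {u : TangentBundle I M}
    (h : α.proj = u.proj) : canonicalPairing α u = (α.2 : E →L[ℝ] ℝ) (u.2 : E) := by
  obtain ⟨x, p⟩ := α
  obtain ⟨y, X⟩ := u
  obtain rfl : x = y := h
  exact dif_pos rfl

section CotangentMap

variable {E' : Type*} [NormedAddCommGroup E'] [NormedSpace ℝ E']
  {H' : Type*} [TopologicalSpace H'] {J : ModelWithCorners ℝ E' H'}
  {N : Type*} [TopologicalSpace N] [ChartedSpace H' N]

theorem canonicalPairing_cotangentMap {F : M → N} {G : N → M} {α : CotangentBundle I M}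
    {u : TangentBundle J N} (hα : G (F α.proj) = α.proj) (hu : F α.proj = u.proj) :
    canonicalPairing (cotangentMap F G α) u = canonicalPairing α (tangentMap J I G u) := by
  obtain ⟨y, X⟩ := u
  obtain rfl : F α.proj = y := hu
  have hleft := canonicalPairing_eq_apply (α := cotangentMap F G α)
    (u := (⟨F α.proj, X⟩ : TangentBundle J N)) rfl
  have hright := canonicalPairing_eq_apply (α := α)
    (u := tangentMap J I G (⟨F α.proj, X⟩ : TangentBundle J N)) hα.symm
  exact hleft.trans hright.symm

end CotangentMap

variable [IsManifold I 1 M]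

theorem trivializationAt_tangentBundle_self (u : TangentBundle I M) :
    (trivializationAt E (TangentSpace I) u.proj u).2 = u.2 := by
  rw [TangentBundle.trivializationAt_apply]
  exact tangentCoordChange_self (mem_extChartAt_source _)

theorem canonicalPairing_eq_trivializationAt (x : M) {α : CotangentBundle I M}
    {u : TangentBundle I M} (h : α.proj = u.proj) (hx : u.proj ∈ (chartAt H x).source) :
    canonicalPairing α u =
      (trivializationAt (E →L[ℝ] ℝ)
        (fun y : M ↦ TangentSpace I y →L[ℝ] Bundle.Trivial M ℝ y) x α).2
        (trivializationAt E (TangentSpace I) x u).2 := by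
  obtain ⟨y, p⟩ := α
  obtain ⟨y', X⟩ := u
  obtain rfl : y = y' := h
  have hy : y ∈ (trivializationAt E (TangentSpace I) x).baseSet := hx
  have hX : (trivializationAt E (TangentSpace I) x).symmL ℝ y
      (trivializationAt E (TangentSpace I) x ⟨y, X⟩).2 = X := by
    rw [← Trivialization.continuousLinearMapAt_apply_of_mem (R := ℝ) _ hy]
    exact Trivialization.symmL_continuousLinearMapAt _ hy X
  rw [canonicalPairing_eq_apply rfl, hom_trivializationAt_apply]
  simp only [ContinuousLinearMap.inCoordinates, Trivial.eq_trivialization,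
    Trivial.continuousLinearMapAt_trivialization]
  exact congrArg p hX.symm

theorem trivializationAt_cotangentBundle_self (α : CotangentBundle I M) :
    (trivializationAt (E →L[ℝ] ℝ)
      (fun x : M ↦ TangentSpace I x →L[ℝ] Bundle.Trivial M ℝ x) α.proj α).2 = α.2 := by
  refine ContinuousLinearMap.ext fun X : E ↦ ?_
  have h := canonicalPairing_eq_trivializationAt α.proj (α := α)
    (u := (⟨α.proj, X⟩ : TangentBundle I M)) rfl (mem_chart_source _ _)
  rw [canonicalPairing_eq_apply rfl,
    trivializationAt_tangentBundle_self (⟨α.proj, X⟩ : TangentBundle I M)] at h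
  exact h.symm

theorem hasDerivAt_canonicalPairing {σ : ℝ → CotangentBundle I M} {γ : ℝ → TangentBundle I M}
    (hσ : MDifferentiableAt 𝓘(ℝ, ℝ) (cotangentModel I) σ 0)
    (hγ : MDifferentiableAt 𝓘(ℝ, ℝ) I.tangent γ 0)
    (hproj : ∀ᶠ t in 𝓝 0, (σ t).proj = (γ t).proj) :
    HasDerivAt (fun t ↦ canonicalPairing (σ t) (γ t))
      (((velocity (cotangentModel I) σ).2 : E × (E →L[ℝ] ℝ)).2 ((γ 0).2 : E) +
        ((σ 0).2 : E →L[ℝ] ℝ) ((velocity I.tangent γ).2 : E × E).2) 0 := by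
  have hcont : ContinuousAt (fun t ↦ (γ t).proj) 0 :=
    (FiberBundle.continuous_proj E (TangentSpace I)).continuousAt.comp hγ.continuousAt
  have hchart : ∀ᶠ t in 𝓝 0, (γ t).proj ∈ (chartAt H (γ 0).proj).source :=
    hcont.eventually_mem (chart_source_mem_nhds H _)
  have hlocal := (hasDerivAt_trivializationAt_snd hσ).clm_apply
    (hasDerivAt_trivializationAt_snd hγ)
  rw [trivializationAt_cotangentBundle_self, trivializationAt_tangentBundle_self] at hlocal
  refine hlocal.congr_of_eventuallyEq ?_
  filter_upwards [hproj, hchart] with t ht hmem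
  rw [hproj.self_of_nhds]
  exact canonicalPairing_eq_trivializationAt _ ht hmem

end CanonicalPairing

section TangentPairing

variable {E : Type*} [NormedAddCommGroup E] [NormedSpace ℝ E]
  {H : Type*} [TopologicalSpace H] {I : ModelWithCorners ℝ E H}
  {Q : Type*} [TopologicalSpace Q] [ChartedSpace H Q] [IsManifold I ∞ Q]
  {v : TangentBundle (cotangentModel I) (CotangentBundle I Q)}
  {u : TangentBundle I.tangent (TangentBundle I Q)}

theorem proj_tulczyjewEquiv (v : TangentBundle (cotangentModel I) (CotangentBundle I Q)) :
    (tulczyjewEquiv v).proj =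
      tangentMap (cotangentModel I) I (TotalSpace.proj : CotangentBundle I Q → Q) v :=
  (tangentMap_totalSpaceProj v).symm

theorem proj_canonicalInvolution (u : TangentBundle I.tangent (TangentBundle I Q)) :
    (canonicalInvolution u).proj =
      tangentMap I.tangent I (TotalSpace.proj : TangentBundle I Q → Q) u :=
  (tangentMap_totalSpaceProj u).symm

theorem canonicalPairing_tulczyjewEquiv_canonicalInvolution
    (h : tangentMap (cotangentModel I) I (TotalSpace.proj : CotangentBundle I Q → Q) v =
      tangentMap I.tangent I (TotalSpace.proj : TangentBundle I Q → Q) u) :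
    canonicalPairing (tulczyjewEquiv v) (canonicalInvolution u) =
      (v.2 : E × (E →L[ℝ] ℝ)).2 (u.proj.2 : E) + (v.proj.2 : E →L[ℝ] ℝ) (u.2 : E × E).2 :=
  canonicalPairing_eq_apply <|
    (proj_tulczyjewEquiv v).trans (h.trans (proj_canonicalInvolution u).symm)

theorem AdaptedCurves.tangentMap_proj_eq {σ : ℝ → CotangentBundle I Q}
    {γ : ℝ → TangentBundle I Q} (h : AdaptedCurves v u σ γ) :
    tangentMap (cotangentModel I) I (TotalSpace.proj : CotangentBundle I Q → Q) v =
      tangentMap I.tangent I (TotalSpace.proj : TangentBundle I Q → Q) u := by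
  obtain ⟨hσ, hγ, hσγ, rfl, rfl⟩ := h
  rw [tangentMap_velocity (hasMFDerivAt_proj _).mdifferentiableAt (hσ.mdifferentiableAt (by simp)),
    tangentMap_velocity (hasMFDerivAt_proj _).mdifferentiableAt (hγ.mdifferentiableAt (by simp))]
  exact tangentMap_congr_of_eventuallyEq hσγ

theorem AdaptedCurves.hasDerivAt {σ : ℝ → CotangentBundle I Q} {γ : ℝ → TangentBundle I Q}
    (h : AdaptedCurves v u σ γ) :
    HasDerivAt (fun t ↦ canonicalPairing (σ t) (γ t))
      (canonicalPairing (tulczyjewEquiv v) (canonicalInvolution u)) 0 := by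
  rw [canonicalPairing_tulczyjewEquiv_canonicalInvolution h.tangentMap_proj_eq]
  obtain ⟨hσ, hγ, hσγ, rfl, rfl⟩ := h
  exact hasDerivAt_canonicalPairing (hσ.mdifferentiableAt (by simp))
    (hγ.mdifferentiableAt (by simp)) hσγ

theorem exists_adaptedCurves [I.Boundaryless]
    (h : tangentMap (cotangentModel I) I (TotalSpace.proj : CotangentBundle I Q → Q) v =
      tangentMap I.tangent I (TotalSpace.proj : TangentBundle I Q → Q) u) :
    ∃ σ γ, AdaptedCurves v u σ γ := by
  obtain ⟨⟨q, p⟩, X : E × (E →L[ℝ] ℝ)⟩ := v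
  obtain ⟨⟨q', x⟩, Y : E × E⟩ := u
  rw [tangentMap_totalSpaceProj, tangentMap_totalSpaceProj] at h
  obtain ⟨rfl, hXY⟩ : q = q' ∧ HEq X.1 Y.1 := TotalSpace.mk.inj h
  refine ⟨chartLine (cotangentModel I) ⟨q, p⟩ X, chartLine I.tangent ⟨q, x⟩ Y,
    contMDiffAt_chartLine _ _, contMDiffAt_chartLine _ _, ?_,
    velocity_chartLine _ _, velocity_chartLine _ _⟩
  filter_upwards [eventually_proj_chartLine (I := I) (⟨q, p⟩ : CotangentBundle I Q) X,
    eventually_proj_chartLine (I := I) (⟨q, x⟩ : TangentBundle I Q) Y] with t hσ hγ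
  rw [hσ, hγ, eq_of_heq hXY]

theorem hasTangentPairing_canonicalPairing [I.Boundaryless]
    (h : tangentMap (cotangentModel I) I (TotalSpace.proj : CotangentBundle I Q → Q) v =
      tangentMap I.tangent I (TotalSpace.proj : TangentBundle I Q → Q) u) :
    HasTangentPairing v u (canonicalPairing (tulczyjewEquiv v) (canonicalInvolution u)) :=
  ⟨exists_adaptedCurves h, fun _ _ hcurves ↦ hcurves.hasDerivAt⟩

theorem HasTangentPairing.tangentPairing_eq {r : ℝ} (h : HasTangentPairing v u r) :
    tangentPairing v u = r := by
  have hex : ∃ r, HasTangentPairing v u r := ⟨r, h⟩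
  obtain ⟨σ, γ, hσγ⟩ := h.1
  rw [tangentPairing, dif_pos hex]
  exact (hex.choose_spec.2 σ γ hσγ).unique (h.2 σ γ hσγ)

end TangentPairing

end DiscretizationMap

open DiscretizationMap in
theorem mainTheorem7_general
    {E : Type*} [NormedAddCommGroup E] [NormedSpace ℝ E]
    {H : Type*} [TopologicalSpace H] (I : ModelWithCorners ℝ E H) [I.Boundaryless]
    {Q : Type*} [TopologicalSpace Q] [ChartedSpace H Q] [IsManifold I ∞ Q]
    (R : TangentBundle I Q → Q × Q)
    (F : PartialDiffeomorph I.tangent (I.prod I) (TangentBundle I Q) (Q × Q) ∞)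
    (hF : EqOn F R F.source)
    (α₀ α₁ : CotangentBundle I Q) (hα : (α₀.proj, α₁.proj) ∈ F.target)
    (w : TangentBundle I.tangent (TangentBundle I Q))
    (hw : F.symm (α₀.proj, α₁.proj) =
      tangentMap I.tangent I (TotalSpace.proj : TangentBundle I Q → Q) w) :
    HasTangentPairing ((cotangentLift F).symm (α₀, α₁)) w
        (tangentPairing ((cotangentLift F).symm (α₀, α₁)) w) ∧
      canonicalPairing (signedProdEquiv (α₀, α₁))
          ((equivTangentBundleProd I Q I Q).symm (tangentLift R w)) =
        tangentPairing ((cotangentLift F).symm (α₀, α₁)) w := by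
  set v := (cotangentLift F).symm (α₀, α₁)
  have hv : tulczyjewEquiv v = cotangentMap F.symm F (signedProdEquiv (α₀, α₁)) :=
    tulczyjewEquiv.apply_symm_apply _
  have hκ : F.symm (α₀.proj, α₁.proj) = (canonicalInvolution w).proj :=
    hw.trans (proj_canonicalInvolution w).symm
  have hpairing : HasTangentPairing v w
      (canonicalPairing (tulczyjewEquiv v) (canonicalInvolution w)) :=
    hasTangentPairing_canonicalPairing <| by rw [← proj_tulczyjewEquiv, hv, ← hw]; rfl
  have hsource : (canonicalInvolution w).proj ∈ F.source := hκ ▸ F.map_target hα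
  have hFR : tangentMap I.tangent (I.prod I) F (canonicalInvolution w) =
      tangentMap I.tangent (I.prod I) R (canonicalInvolution w) :=
    tangentMap_congr_of_eventuallyEq (hF.eventuallyEq_of_mem (F.open_source.mem_nhds hsource))
  rw [hpairing.tangentPairing_eq]
  refine ⟨hpairing, ?_⟩
  rw [tangentLift, Equiv.symm_apply_apply, hv, ← hFR]
  exact (canonicalPairing_cotangentMap (α := signedProdEquiv (α₀, α₁)) (F.right_inv hα) hκ).symm

theorem mainTheorem7
    {E : Type*} [NormedAddCommGroup E] [NormedSpace ℝ E] [FiniteDimensional ℝ E]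
    {H : Type*} [TopologicalSpace H] (I : ModelWithCorners ℝ E H) [I.Boundaryless]
    {Q : Type*} [TopologicalSpace Q] [ChartedSpace H Q] [IsManifold I ∞ Q]
    (U : Set (TangentBundle I Q)) (R : TangentBundle I Q → Q × Q)
    (hR : DiscretizationMap.IsDiscretizationMap U R)
    (F : PartialDiffeomorph I.tangent (I.prod I) (TangentBundle I Q) (Q × Q) ∞)
    (hFU : F.source ⊆ U) (hF : Set.EqOn F R F.source)
    (α₀ α₁ : DiscretizationMap.CotangentBundle I Q) (hα : (α₀.proj, α₁.proj) ∈ F.target)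
    (w : TangentBundle I.tangent (TangentBundle I Q))
    (hw : F.symm (α₀.proj, α₁.proj) =
      tangentMap I.tangent I (TotalSpace.proj : TangentBundle I Q → Q) w) :
    DiscretizationMap.HasTangentPairing
        ((DiscretizationMap.cotangentLift F).symm (α₀, α₁)) w
        (DiscretizationMap.tangentPairing
          ((DiscretizationMap.cotangentLift F).symm (α₀, α₁)) w) ∧
      DiscretizationMap.canonicalPairing (DiscretizationMap.signedProdEquiv (α₀, α₁))
          ((equivTangentBundleProd I Q I Q).symm (DiscretizationMap.tangentLift R w)) =
        DiscretizationMap.tangentPairing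
          ((DiscretizationMap.cotangentLift F).symm (α₀, α₁)) w :=
  mainTheorem7_general I R F hF α₀ α₁ hα w hw
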